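/- Let $\mathbb F$ be a finite field and let $n,k,\delta$ be integers with $0<k<n$, $\delta\ge 0$ and $k\nmid\delta$. Put $m=\lfloor \delta/k\rfloor+1$ and $L=\lfloor \delta/(n-k)\rfloor+m-1$. Let $G(z)=\sum_{i=0}^{m}G_iz^i\in\mathbb F[z]^{k\times n}$ with $G_i\in\mathbb F^{k\times n}$, and put $G_i=0$ for $i>m$. Suppose the following. (a) $G(z)$ is row-reduced: its rows are linearly independent over $\mathbb F[z]$, and the sum of its row degrees is minimal among all $k\times n$ matrices whose rows form a basis of the $\mathbb F[z]$-row module of $G(z)$. (b) Let $G_L^c\in\mathbb F^{(L+1)k\times(L+1)n}$ be the block upper triangular matrix whose block in position $(p,q)$, $0\le p,q\le L$, is $G_{q-p}$ if $p\le q$ and $0$ otherwise. Every full-size minor of $G_L^c$ that is not trivially zero is nonzero, that is, every minor formed by columns $1\le t_1<\dots<t_{(L+1)k}\le (L+1)n$ with $t_{sk+1}>sn$ for $s=1,\dots,L$ is nonzero. (c) There are $r\in\mathbb N_0$ and $S\subseteq\{1,\dots,k\}$ with $|S|=\delta-k\lfloor\delta/k\rfloor$ such that the rows of $G_m$ with index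 outside $S$ are zero and the matrix $$\bar G=\begin{bmatrix}G_0\\ \vdots&\ddots\\ G_m&&G_0\\ &\ddots&\vdots\\ &&\tilde G_m\end{bmatrix}\in\mathbb F^{(k(r+m)+|S|)\times n(r+1)}$$ has full row rank. Here $\tilde G_m$ consists of the rows of $G_m$ with index in $S$; that is, $\bar G$ has block columns $q=0,\dots,r$ and block rows $p=0,\dots,r+m$, with block $G_{p-q}$ if $0\le p-q\le m$ and $0$ otherwise, where only the rows with index in $S$ are kept in the last block row $p=r+m$. Then the rows of $G(z)$ form a basis of a noncatastrophic $(n,k,\delta)$ MDP convolutional code $\mathcal C$. That is: $\mathcal C$ is a submodule of $\mathbb F[z]^n$ of rank $k$; the highest degree of the $k\times k$ minors of a generator matrix (a matrix whose rows form a basis of $\mathcal C$) is $\delta$; $\mathcal C$ has a left prime generator matrix, i.e. one for which the factor $M(z)$ in every factorization $M(z)G'(z)$ with $M(z)\in\mathbb F[z]^{k\times k}$ and $G'(z)\in\mathbb F[z]^{k\times n}$ is unimodular; and for all $0\le j\le \lfloor\delta/k\rfloor+\lfloor\delta/(n-k)\rfloor$ the $j$-th column distance $$d_j^c(\mathcal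 C)=\min\Big\{\sum_{i=0}^{j}\mathrm{wt}(v_i)\ :\ v(z)=\sum_i v_iz^i\in\mathcal C,\ v_0\neq 0\Big\}$$ ($\mathrm{wt}$ being the Hamming weight on $\mathbb F^n$) equals $(n-k)(j+1)+1$. -/

import Mathlib

open Polynomial

namespace ConvCode

variable {F : Type*} [Field F] {n k : ℕ}

/-- `G` is a generator matrix of the submodule `C` of `F[z]^n`: its rows form a basis of `C`. -/
def IsGeneratorMatrix (C : Submodule F[X] (Fin n → F[X])) (G : Matrix (Fin k) (Fin n) F[X]) :
    Prop :=
  LinearIndependent F[X] G.row ∧ Submodule.span F[X] (Set.range G.row) = C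

/-- The `i`-th row degree: the largest degree among the entries of the `i`-th row. -/
def rowDegree (G : Matrix (Fin k) (Fin n) F[X]) (i : Fin k) : ℕ :=
  Finset.univ.sup fun j => (G i j).natDegree

/-- `G` is row-reduced: it has linearly independent rows, and the sum of its row degrees is minimal
among all generator matrices of the code that it generates. -/
def IsRowReduced (G : Matrix (Fin k) (Fin n) F[X]) : Prop :=
  LinearIndependent F[X] G.row ∧
    ∀ G' : Matrix (Fin k) (Fin n) F[X],
      IsGeneratorMatrix (Submodule.span F[X] (Set.range G.row)) G' →
        ∑ i, rowDegree G i ≤ ∑ i, rowDegree G' i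

/-- `C` is an `(n, k, δ)` convolutional code: a submodule of `F[z]^n` of rank `k`, such that `δ` is
the highest degree of the (nonzero) `k × k` minors of a generator matrix. -/
def IsConvolutionalCode (C : Submodule F[X] (Fin n → F[X])) (k δ : ℕ) : Prop :=
  Module.finrank F[X] C = k ∧
    ∃ G : Matrix (Fin k) (Fin n) F[X], IsGeneratorMatrix C G ∧
      IsGreatest {d : ℕ | ∃ t : Fin k → Fin n, StrictMono t ∧
        (G.submatrix id t).det ≠ 0 ∧ (G.submatrix id t).det.natDegree = d} δ

/-- `G` is left prime: every square left factor of `G` is unimodular. -/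
def IsLeftPrime (G : Matrix (Fin k) (Fin n) F[X]) : Prop :=
  ∀ (M : Matrix (Fin k) (Fin k) F[X]) (G' : Matrix (Fin k) (Fin n) F[X]), G = M * G' → IsUnit M

/-- The code `C` of rank `k` is noncatastrophic: it admits a left prime generator matrix. -/
def IsNoncatastrophic (C : Submodule F[X] (Fin n → F[X])) (k : ℕ) : Prop :=
  ∃ G : Matrix (Fin k) (Fin n) F[X], IsGeneratorMatrix C G ∧ IsLeftPrime G

open Classical in
/-- The weight of the truncation `v_0 + v_1 z + ⋯ + v_j z^j` of `v(z)`, i.e. the sum of the Hamming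
weights of `v_0, …, v_j`. -/
noncomputable def truncWeight (v : Fin n → F[X]) (j : ℕ) : ℕ :=
  ∑ i ∈ Finset.range (j + 1), hammingNorm fun a => (v a).coeff i

/-- The `j`-th column distance: the minimal weight of `v_0 + ⋯ + v_j z^j` over the codewords `v(z)`
with `v_0 ≠ 0`. -/
noncomputable def columnDistance (C : Submodule F[X] (Fin n → F[X])) (j : ℕ) : ℕ :=
  sInf {w : ℕ | ∃ v ∈ C, (fun a => (v a).coeff 0) ≠ 0 ∧ truncWeight v j = w}

/-- The MDP property of an `(n, k, δ)` code: its column distances meet the bound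
`d_j ≤ (n - k)(j + 1) + 1` with equality for all `j = 0, …, L = ⌊δ/k⌋ + ⌊δ/(n-k)⌋`. -/
def IsMDP (C : Submodule F[X] (Fin n → F[X])) (k δ : ℕ) : Prop :=
  ∀ j ≤ δ / k + δ / (n - k), columnDistance C j = (n - k) * (j + 1) + 1

/-- The `j`-th truncated sliding generator matrix `G_j^c`, the block upper triangular Toeplitz
matrix whose block in block row `p` and block column `q` is `G_{q-p}` if `p ≤ q`, and zero
otherwise. -/
noncomputable def slidingGenerator (G : Matrix (Fin k) (Fin n) F[X]) (j : ℕ) :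
    Matrix (Fin ((j + 1) * k)) (Fin ((j + 1) * n)) F :=
  Matrix.of fun a b =>
    if a.divNat ≤ b.divNat then
      (G a.modNat b.modNat).coeff ((b.divNat : ℕ) - (a.divNat : ℕ))
    else 0

/-- All full-size minors of `G_j^c` that are not trivially zero are nonzero: these are the minors
formed by columns `t_1 < ⋯ < t_{(j+1)k}` with `t_{sk+1} > sn` for `s = 1, …, j`. Here rows and
columns are numbered from `0`, so that the condition becomes `t (s * k) ≥ s * n`. -/
def MinorCriterion (G : Matrix (Fin k) (Fin n) F[X]) (j : ℕ) : Prop :=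
  ∀ t : Fin ((j + 1) * k) → Fin ((j + 1) * n), StrictMono t →
    (∀ (s : ℕ) (i : Fin ((j + 1) * k)), 1 ≤ s → s ≤ j → (i : ℕ) = s * k → s * n ≤ (t i : ℕ)) →
      ((slidingGenerator G j).submatrix id t).det ≠ 0

/-- The matrix with block columns `0, …, r` and block rows `0, …, r + m`, whose block in block row
`p` and block column `q` is `G_{p-q}` if `0 ≤ p - q ≤ m` and zero otherwise, where only
the rows with index in `S` are kept in the last block row `p = r + m`. -/
noncomputable def slidingBar (G : Matrix (Fin k) (Fin n) F[X]) (m r : ℕ) (S : Finset (Fin k)) :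
    Matrix {p : Fin (r + m + 1) × Fin k // (p.1 : ℕ) < r + m ∨ p.2 ∈ S} (Fin (r + 1) × Fin n) F :=
  Matrix.of fun p q =>
    if (q.1 : ℕ) ≤ (p.1.1 : ℕ) ∧ (p.1.1 : ℕ) ≤ (q.1 : ℕ) + m then
      (G p.1.2 q.2).coeff ((p.1.1 : ℕ) - (q.1 : ℕ))
    else 0

end ConvCode

/-! Write a codeword as `v = u G`; modulo `z^(j+1)` its coefficients are those of `u` times `G_j^c`.

Column distances: if `v_0, …, v_j` had weight at most `(n-k)(j+1)`, they would have at least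
`(j+1)k` zeros. By induction each shorter truncation is heavy, so the zeros do not cluster early and
the first `(j+1)k` of them index a minor that is not trivially zero. That minor is nonzero, forcing
`u_0 = 0`. Conversely, `G(0)` has an invertible `k × k` block, which can be inverted modulo
`z^(j+1)` to build a codeword attaining the bound.

Degree: the last block column of `slidingBar` shows that the coefficients of `G` at row degrees `m`
(in `S`) and `m - 1` (outside) are independent, so the maximal minor degree is the sum of these
degrees, `δ`.

Noncatastrophicity: if a left factor is not unimodular, `w G(l) = 0` for some `l` and `w ≠ 0` over
the algebraic closure; the vectors `l^p w` then give a dependency among the rows of `slidingBar`. -/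

namespace ConvCode

section Aux

variable {F : Type*} [Field F] {n k : ℕ}

/-! ### Sliding generator matrices and the minor criterion -/

/-- The coefficient sequence of `u * G`, cut off after `z^j`, is the product of the coefficient
sequence of `u` with the sliding generator matrix. -/
theorem vecMul_slidingGenerator (G : Matrix (Fin k) (Fin n) F[X]) (j : ℕ) (u : Fin k → F[X])
    (b : Fin ((j + 1) * n)) :
    Matrix.vecMul (fun a : Fin ((j + 1) * k) => (u a.modNat).coeff a.divNat)
      (slidingGenerator G j) b = (Matrix.vecMul u G b.modNat).coeff b.divNat := by
  simp only [Matrix.vecMul, dotProduct, slidingGenerator, Matrix.of_apply]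
  rw [← Equiv.sum_comp finProdFinEquiv, Fintype.sum_prod_type, Finset.sum_comm, finsetSum_coeff]
  refine Finset.sum_congr rfl fun a _ => ?_
  rw [coeff_mul, Finset.Nat.sum_antidiagonal_eq_sum_range_succ_mk]
  have h1 : ∀ p : Fin (j + 1), (finProdFinEquiv (p, a)).divNat = p := fun p =>
    congrArg Prod.fst (finProdFinEquiv.symm_apply_apply (p, a))
  have h2 : ∀ p : Fin (j + 1), (finProdFinEquiv (p, a)).modNat = a := fun p =>
    congrArg Prod.snd (finProdFinEquiv.symm_apply_apply (p, a))
  simp only [h1, h2, ← Fin.val_fin_le]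
  rw [Fin.sum_univ_eq_sum_range (fun p => (u a).coeff p *
    if p ≤ (b.divNat : ℕ) then (G a b.modNat).coeff ((b.divNat : ℕ) - p) else 0)]
  have hb : (b.divNat : ℕ) < j + 1 := b.divNat.2
  rw [← Finset.sum_subset (Finset.range_mono (Nat.succ_le_of_lt hb))]
  · refine Finset.sum_congr rfl fun p hp => ?_
    rw [if_pos (Nat.lt_succ_iff.1 (Finset.mem_range.1 hp))]
  · intro p _ hp
    rw [if_neg (fun h => hp (Finset.mem_range.2 (Nat.lt_succ_of_le h))), mul_zero]

/-- The minor criterion passes to shorter sliding generator matrices. -/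
theorem MinorCriterion.mono {G : Matrix (Fin k) (Fin n) F[X]} {j L : ℕ} (hk : 0 < k) (hkn : k ≤ n)
    (hjL : j ≤ L) (h : MinorCriterion G L) : MinorCriterion G j := by
  intro t ht hts hdet
  have hle : ∀ q, (j + 1) * q ≤ (L + 1) * q := fun q => Nat.mul_le_mul_right q (by omega)
  have hn : 0 < n := hk.trans_le hkn
  have hlt : ∀ i : Fin ((L + 1) * k), (i : ℕ) / k * n + i % k < (L + 1) * n := fun i => by
    have h1 : (i : ℕ) / k < L + 1 := (Nat.div_lt_iff_lt_mul hk).2 i.2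
    have h2 := Nat.mod_lt (i : ℕ) hk
    nlinarith
  -- Extend `t` by the first `k` columns of every later block; the result is still not trivially
  -- zero.
  set t' : Fin ((L + 1) * k) → Fin ((L + 1) * n) := fun i =>
    if hi : (i : ℕ) < (j + 1) * k then Fin.castLE (hle n) (t ⟨i, hi⟩)
    else ⟨(i : ℕ) / k * n + i % k, hlt i⟩ with ht'
  have htlt : ∀ i hi, t' i = Fin.castLE (hle n) (t ⟨i, hi⟩) := fun i hi => by
    simp only [ht']; rw [dif_pos hi]
  have htge : ∀ i : Fin ((L + 1) * k), ¬ (i : ℕ) < (j + 1) * k →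
      (t' i : ℕ) = (i : ℕ) / k * n + i % k := fun i hi => by
    simp only [ht']; rw [dif_neg hi]
  have hdivge : ∀ i : Fin ((L + 1) * k), ¬ (i : ℕ) < (j + 1) * k → j + 1 ≤ (i : ℕ) / k :=
    fun i hi => (Nat.le_div_iff_mul_le hk).2 (not_lt.1 hi)
  obtain ⟨y, hy, hy0⟩ := Matrix.exists_mulVec_eq_zero_iff.2 hdet
  refine h t' ?_ ?_ ?_
  · intro i i' hii
    have hii' : (i : ℕ) < i' := hii
    rw [Fin.lt_def]
    by_cases hi' : (i' : ℕ) < (j + 1) * k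
    · rw [htlt i (hii'.trans hi'), htlt i' hi']
      exact ht hii'
    · rw [htge i' hi']
      by_cases hi : (i : ℕ) < (j + 1) * k
      · rw [htlt i hi]
        have := (t ⟨i, hi⟩).2
        have h3 := Nat.mul_le_mul_right n (hdivge i' hi')
        rw [Fin.val_castLE]
        omega
      · rw [htge i hi]
        have h1 := Nat.div_add_mod (i : ℕ) k
        have h2 := Nat.div_add_mod (i' : ℕ) k
        have h3 := Nat.mod_lt (i : ℕ) hk
        have h4 : (i : ℕ) / k ≤ i' / k := Nat.div_le_div_right hii'.le
        rcases h4.eq_or_lt with h5 | h5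
        · rw [h5] at h1 ⊢
          omega
        · nlinarith
  · intro s i hs hsL hi
    by_cases hi' : (i : ℕ) < (j + 1) * k
    · rw [htlt i hi']
      refine hts s ⟨i, hi'⟩ hs ?_ hi
      rw [hi] at hi'
      exact Nat.lt_succ_iff.1 (lt_of_mul_lt_mul_right hi' (Nat.zero_le k))
    · rw [htge i hi', hi, Nat.mul_div_cancel _ hk, Nat.mul_mod_left]
      omega
  -- A kernel vector of the small minor, padded with zeros, is killed by the large one: the later
  -- rows vanish on the first `j + 1` block columns.
  · refine Matrix.exists_mulVec_eq_zero_iff.1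
      ⟨fun i => if hi : (i : ℕ) < (j + 1) * k then y ⟨i, hi⟩ else 0, ?_, ?_⟩
    · intro h0
      refine hy (funext fun i => ?_)
      have := congrFun h0 (Fin.castLE (hle k) i)
      simpa using this
    · ext a
      have hsum : ∀ g : Fin ((L + 1) * k) → F,
          (∀ i : Fin ((L + 1) * k), ¬ (i : ℕ) < (j + 1) * k → g i = 0) →
          ∑ i, g i = ∑ i, g (Fin.castLE (hle k) i) := fun g hg => by
        refine (Fintype.sum_of_injective (Fin.castLE (hle k)) (Fin.castLE_injective _) _ _ ?_
          fun _ => rfl).symm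
        intro i hi
        exact hg i fun hi' => hi ⟨⟨i, hi'⟩, rfl⟩
      simp only [Matrix.mulVec, dotProduct, Pi.zero_apply]
      rw [hsum _ fun i hi => by rw [dif_neg hi, mul_zero]]
      by_cases ha : (a : ℕ) < (j + 1) * k
      · have := congrFun hy0 ⟨a, ha⟩
        simp only [Matrix.mulVec, dotProduct, Pi.zero_apply] at this
        rw [← this]
        refine Finset.sum_congr rfl fun i _ => ?_
        have hi : ((Fin.castLE (hle k) i : Fin ((L + 1) * k)) : ℕ) < (j + 1) * k := i.2
        rw [dif_pos hi, Matrix.submatrix_apply, Matrix.submatrix_apply, htlt _ hi]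
        rfl
      · refine Finset.sum_eq_zero fun i _ => ?_
        have hi : ((Fin.castLE (hle k) i : Fin ((L + 1) * k)) : ℕ) < (j + 1) * k := i.2
        rw [Matrix.submatrix_apply, htlt _ hi]
        simp only [slidingGenerator, Matrix.of_apply]
        rw [if_neg, zero_mul]
        rw [Fin.le_def, not_le]
        simp only [id, Fin.coe_divNat, Fin.val_castLE]
        exact ((Nat.div_lt_iff_lt_mul hn).2 (t _).2).trans_le (hdivge a ha)

/-- If the minor criterion holds and `u * G` vanishes at the positions listed by `t`, then the
constant coefficients of `u` vanish. -/
theorem MinorCriterion.coeff_zero_eq_zero {G : Matrix (Fin k) (Fin n) F[X]} {j : ℕ}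
    (h : MinorCriterion G j)
    (t : Fin ((j + 1) * k) → Fin ((j + 1) * n)) (ht : StrictMono t)
    (hts : ∀ (s : ℕ) (i : Fin ((j + 1) * k)), 1 ≤ s → s ≤ j → (i : ℕ) = s * k →
      s * n ≤ (t i : ℕ))
    (u : Fin k → F[X])
    (hu : ∀ i, (Matrix.vecMul u G (t i).modNat).coeff (t i).divNat = 0) (a : Fin k) :
    (u a).coeff 0 = 0 := by
  have h0 := Matrix.eq_zero_of_vecMul_eq_zero (h t ht hts)
    (v := fun a : Fin ((j + 1) * k) => (u a.modNat).coeff a.divNat) (by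
      ext i
      rw [Pi.zero_apply, ← hu i, ← vecMul_slidingGenerator]
      rfl)
  have h1 := congrFun h0 (finProdFinEquiv (0, a))
  have h2 : (finProdFinEquiv ((0 : Fin (j + 1)), a)).divNat = 0 :=
    congrArg Prod.fst (finProdFinEquiv.symm_apply_apply ((0 : Fin (j + 1)), a))
  have h3 : (finProdFinEquiv ((0 : Fin (j + 1)), a)).modNat = a :=
    congrArg Prod.snd (finProdFinEquiv.symm_apply_apply ((0 : Fin (j + 1)), a))
  simp only [h2, h3] at h1
  exact h1

/-! ### Counting zeros: the lower bound for column distances -/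

/-- Position `b = i * n + c` of the coefficient sequence of `v` holds the coefficient of `z^i` in
the `c`-th entry; this predicate says that it is zero. -/
def IsZeroAt (v : Fin n → F[X]) (b : ℕ) : Prop :=
  ∀ c : Fin n, (c : ℕ) = b % n → (v c).coeff (b / n) = 0

open Classical in
theorem count_isZeroAt (v : Fin n → F[X]) (s : ℕ) :
    Nat.count (IsZeroAt v) (s * n) +
      ∑ i ∈ Finset.range s, hammingNorm (fun a => (v a).coeff i) = s * n := by
  induction s with
  | zero => simp
  | succ s ih =>
    have hiff : ∀ a : Fin n, IsZeroAt v (s * n + a) ↔ (v a).coeff s = 0 := fun a => by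
      have h1 : (s * n + (a : ℕ)) / n = s := by
        rw [mul_comm, Nat.mul_add_div a.pos, Nat.div_eq_of_lt a.2, add_zero]
      have h2 : (s * n + (a : ℕ)) % n = a := by
        rw [mul_comm, Nat.mul_add_mod, Nat.mod_eq_of_lt a.2]
      unfold IsZeroAt
      rw [h1, h2]
      exact ⟨fun h => h a rfl, fun h c hc => (Fin.ext hc : c = a) ▸ h⟩
    have key : Nat.count (fun b => IsZeroAt v (s * n + b)) n +
        hammingNorm (fun a => (v a).coeff s) = n := by
      have h1 : Nat.count (fun b => IsZeroAt v (s * n + b)) n =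
          (Finset.univ.filter fun a : Fin n => (v a).coeff s = 0).card := by
        rw [Nat.count_eq_card_filter_range]
        refine (Finset.card_bij (fun (a : Fin n) _ => (a : ℕ)) ?_ (fun _ _ _ _ h => Fin.ext h)
          ?_).symm
        · intro a ha
          rw [Finset.mem_filter, Finset.mem_range]
          exact ⟨a.2, (hiff a).2 (Finset.mem_filter.1 ha).2⟩
        · intro b hb
          rw [Finset.mem_filter, Finset.mem_range] at hb
          exact ⟨⟨b, hb.1⟩, Finset.mem_filter.2 ⟨Finset.mem_univ _, (hiff ⟨b, hb.1⟩).1 hb.2⟩, rfl⟩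
      have h2 := Finset.card_filter_add_card_filter_not (s := (Finset.univ : Finset (Fin n)))
        (fun a => (v a).coeff s = 0)
      rw [h1, hammingNorm]
      simpa using h2
    rw [Finset.sum_range_succ, add_mul, one_mul, Nat.count_add]
    omega

/-- Ensures that `Nat.nth` enumerates the zeros strictly increasingly and never takes its default
value. -/
theorem infinite_isZeroAt (hn : 0 < n) (v : Fin n → F[X]) :
    (Set.ofPred (IsZeroAt v)).Infinite := by
  refine Set.infinite_of_forall_exists_gt fun N => ?_
  set D := Finset.univ.sup fun c => (v c).natDegree with hD
  refine ⟨(N + D + 1) * n, fun c _ => ?_, by nlinarith⟩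
  rw [Nat.mul_div_cancel _ hn]
  refine coeff_eq_zero_of_natDegree_lt ?_
  have : (v c).natDegree ≤ D := Finset.le_sup (f := fun c => (v c).natDegree) (Finset.mem_univ c)
  omega

open Classical in
/-- Lower bound for the weight of truncated codewords. -/
theorem MinorCriterion.lt_truncWeight {G : Matrix (Fin k) (Fin n) F[X]} {L : ℕ} (hk : 0 < k)
    (hkn : k ≤ n) (h : MinorCriterion G L) (u : Fin k → F[X]) (a : Fin k)
    (hu : (u a).coeff 0 ≠ 0) (j : ℕ) (hj : j ≤ L) :
    (n - k) * (j + 1) < truncWeight (Matrix.vecMul u G) j := by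
  have hn : 0 < n := hk.trans_le hkn
  induction j using Nat.strong_induction_on with
  | _ j ih =>
    by_contra! hw
    set v := Matrix.vecMul u G with hv
    have hinf := infinite_isZeroAt hn v
    have hsplit : ∀ s, (n - k) * s + s * k = s * n := fun s => by
      rw [mul_comm, ← mul_add, Nat.sub_add_cancel hkn]
    have hcount : (j + 1) * k ≤ Nat.count (IsZeroAt v) ((j + 1) * n) := by
      have h1 := count_isZeroAt v (j + 1)
      have h2 := hsplit (j + 1)
      have h3 : ∑ i ∈ Finset.range (j + 1), hammingNorm (fun a => (v a).coeff i) ≤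
        (n - k) * (j + 1) := hw
      omega
    have hlt : ∀ i : Fin ((j + 1) * k), Nat.nth (IsZeroAt v) i < (j + 1) * n := fun i =>
      Nat.nth_lt_of_lt_count (i.2.trans_le hcount)
    refine hu ((h.mono hk hkn hj).coeff_zero_eq_zero
      (fun i => ⟨Nat.nth (IsZeroAt v) i, hlt i⟩) ?_ ?_ u ?_ a)
    · intro i i' hii
      exact Nat.nth_strictMono hinf hii
    -- By induction the first `s` blocks have weight above `(n-k)s`, hence fewer than `s * k` zeros,
    -- so the zero with index `s * k` (counted from 0) lies at or beyond position `s * n`.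
    · intro s i hs hsj hi
      obtain ⟨s, rfl⟩ : ∃ s', s = s' + 1 := ⟨s - 1, by omega⟩
      have h1 := count_isZeroAt v (s + 1)
      have h2 := hsplit (s + 1)
      have h3 : (n - k) * (s + 1) <
        ∑ i ∈ Finset.range (s + 1), hammingNorm (fun a => (v a).coeff i) :=
        ih s (by omega) (by omega)
      refine (Nat.le_nth_count hinf ((s + 1) * n)).trans ((Nat.nth_strictMono hinf).monotone ?_)
      omega
    · intro i
      exact Nat.nth_mem_of_infinite hinf i _ rfl

/-! ### The upper bound and the exact column distances -/

/-- Under the minor criterion the first `k` columns of `G(0)` form an invertible matrix. -/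
theorem MinorCriterion.coeff_zero_det_ne_zero {G : Matrix (Fin k) (Fin n) F[X]} {L : ℕ}
    (hk : 0 < k) (hkn : k ≤ n) (h : MinorCriterion G L) :
    (G.submatrix id (Fin.castLE hkn)).det.coeff 0 ≠ 0 := by
  have hn : 0 < n := hk.trans_le hkn
  rw [coeff_zero_eq_eval_zero, ← coe_evalRingHom, RingHom.map_det]
  intro hdet
  obtain ⟨w, hw, hw0⟩ := Matrix.exists_vecMul_eq_zero_iff.2 hdet
  refine hw (funext fun a => ?_)
  have h1 := (h.mono hk hkn (Nat.zero_le L)).coeff_zero_eq_zero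
    (Fin.castLE (Nat.mul_le_mul_left _ hkn)) (fun i i' hii => hii)
    (fun s i hs hs' _ => by omega) (fun a => C (w a)) (fun i => ?_) a
  · simpa using h1
  · have hi : (i : ℕ) < k := by simpa using i.2
    have h2 := congrFun hw0 ⟨i, hi⟩
    have h3 : ((Fin.castLE (Nat.mul_le_mul_left _ hkn) i : Fin ((0 + 1) * n)).divNat : ℕ) = 0 := by
      rw [Fin.coe_divNat, Fin.val_castLE]
      exact Nat.div_eq_of_lt (hi.trans_le hkn)
    have h4 : (Fin.castLE (Nat.mul_le_mul_left _ hkn) i : Fin ((0 + 1) * n)).modNat =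
        Fin.castLE hkn ⟨i, hi⟩ := by
      ext
      rw [Fin.coe_modNat, Fin.val_castLE, Fin.val_castLE]
      exact Nat.mod_eq_of_lt (hi.trans_le hkn)
    rw [h3, h4]
    simp only [Matrix.vecMul, dotProduct, finsetSum_coeff, coeff_C_mul, Pi.zero_apply] at h2 ⊢
    rw [← h2]
    refine Finset.sum_congr rfl fun b _ => ?_
    simp [coeff_zero_eq_eval_zero]

/-- If the first `k` columns of `G(0)` form an invertible matrix, then some codeword attains the
upper bound for the `j`-th column distance. -/
theorem exists_truncWeight_le {G : Matrix (Fin k) (Fin n) F[X]} (hk : 0 < k) (hkn : k ≤ n)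
    (hdet : (G.submatrix id (Fin.castLE hkn)).det.coeff 0 ≠ 0) (j : ℕ) :
    ∃ u : Fin k → F[X], (fun a => (Matrix.vecMul u G a).coeff 0) ≠ 0 ∧
      truncWeight (Matrix.vecMul u G) j ≤ (n - k) * (j + 1) + 1 := by
  classical
  set A := G.submatrix id (Fin.castLE hkn) with hA
  have hcop : IsCoprime A.det (X ^ (j + 1)) := by
    refine IsCoprime.pow_right (IsCoprime.symm ?_)
    refine (prime_X.irreducible.coprime_iff_not_dvd).2 ?_
    rwa [X_dvd_iff]
  obtain ⟨x, y, hxy⟩ := hcop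
  set e : Fin k := ⟨0, hk⟩
  -- Since `x` inverts `det A` modulo `X^(j+1)`, this is the first row of an inverse of `A` modulo
  -- `X^(j+1)`; up to `z^j`, the first `k` entries of `u G` have a single nonzero coefficient.
  set u : Fin k → F[X] := fun i => x * A.adjugate e i with hu
  have huA : ∀ c : Fin k, Matrix.vecMul u G (Fin.castLE hkn c) =
      if e = c then 1 - y * X ^ (j + 1) else 0 := fun c => by
    have h1 : Matrix.vecMul u G (Fin.castLE hkn c) = x * (A.adjugate * A) e c := by
      simp only [Matrix.vecMul, dotProduct, Matrix.mul_apply, Finset.mul_sum, hu, hA,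
        Matrix.submatrix_apply, id, mul_assoc]
    rw [h1, Matrix.adjugate_mul, Matrix.smul_apply, Matrix.one_apply, smul_eq_mul]
    split_ifs
    · rw [mul_one, ← hxy]; ring
    · simp
  have hcoeff : ∀ (c : Fin k) (i : ℕ), i ≤ j →
      (Matrix.vecMul u G (Fin.castLE hkn c)).coeff i = if e = c ∧ i = 0 then 1 else 0 := by
    intro c i hi
    rw [huA]
    by_cases hc : e = c
    · rw [if_pos hc, coeff_sub, coeff_mul_X_pow', if_neg (by omega), coeff_one]
      simp [hc]
    · simp [hc]
  refine ⟨u, fun h0 => ?_, ?_⟩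
  · have := congrFun h0 (Fin.castLE hkn e)
    simp only [hcoeff e 0 (Nat.zero_le j)] at this
    simp at this
  · set v := Matrix.vecMul u G with hv
    have hbound : ∀ i ∈ Finset.range (j + 1), hammingNorm (fun a => (v a).coeff i) ≤
        (n - k) + if i = 0 then 1 else 0 := by
      intro i hi
      have hi' : i ≤ j := Nat.lt_succ_iff.1 (Finset.mem_range.1 hi)
      have hsub : (Finset.univ.filter fun a : Fin n => (v a).coeff i ≠ 0) ⊆
          (Finset.univ.filter fun a : Fin n => k ≤ (a : ℕ)) ∪
            if i = 0 then {Fin.castLE hkn e} else ∅ := by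
        intro a ha
        rw [Finset.mem_filter] at ha
        rw [Finset.mem_union, Finset.mem_filter]
        by_cases hak : k ≤ (a : ℕ)
        · exact Or.inl ⟨Finset.mem_univ _, hak⟩
        · right
          have h1 := ha.2
          have h2 := hcoeff ⟨a, not_le.1 hak⟩ i hi'
          have h3 : Fin.castLE hkn ⟨a, not_le.1 hak⟩ = a := rfl
          rw [h3] at h2
          rw [h2] at h1
          have h4 := (ite_ne_right_iff.1 h1).1
          rw [if_pos h4.2, Finset.mem_singleton, h4.1]
          exact h3.symm
      have hcard : (Finset.univ.filter fun a : Fin n => k ≤ (a : ℕ)).card = n - k := by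
        have h1 := Finset.card_filter_add_card_filter_not (s := (Finset.univ : Finset (Fin n)))
          (fun a => (a : ℕ) < k)
        have h2 : (Finset.univ.filter fun a : Fin n => (a : ℕ) < k).card = k := by
          rw [Fin.card_filter_val_lt]
          exact min_eq_right hkn
        simp only [not_lt, Finset.card_univ, Fintype.card_fin] at h1
        omega
      unfold hammingNorm
      refine le_trans (le_of_eq ?_)
        ((Finset.card_le_card hsub).trans ((Finset.card_union_le _ _).trans ?_))
      · congr
      · rw [hcard]
        split_ifs <;> simp
    unfold truncWeight
    have h1 := Finset.sum_le_sum hbound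
    rw [Finset.sum_add_distrib, Finset.sum_const, Finset.card_range, smul_eq_mul,
      Finset.sum_ite_eq' (Finset.range (j + 1)) 0 (fun _ => 1),
      if_pos (Finset.mem_range.2 (Nat.succ_pos j)), mul_comm] at h1
    convert h1

theorem mem_span_row_iff (G : Matrix (Fin k) (Fin n) F[X]) (v : Fin n → F[X]) :
    v ∈ Submodule.span F[X] (Set.range G.row) ↔ ∃ u, Matrix.vecMul u G = v := by
  rw [← range_vecMulLinear]
  rfl

/-- The minor criterion for `G` gives optimal column distances. -/
theorem MinorCriterion.columnDistance_eq {G : Matrix (Fin k) (Fin n) F[X]} {L : ℕ} (hk : 0 < k)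
    (hkn : k ≤ n) (h : MinorCriterion G L) (j : ℕ) (hj : j ≤ L) :
    columnDistance (Submodule.span F[X] (Set.range G.row)) j = (n - k) * (j + 1) + 1 := by
  unfold columnDistance
  obtain ⟨u, hu, huw⟩ := exists_truncWeight_le hk hkn (h.coeff_zero_det_ne_zero hk hkn) j
  have hmem : truncWeight (Matrix.vecMul u G) j ∈ {w : ℕ | ∃ v ∈ Submodule.span F[X]
      (Set.range G.row), (fun a => (v a).coeff 0) ≠ 0 ∧ truncWeight v j = w} :=
    ⟨_, (mem_span_row_iff G _).2 ⟨u, rfl⟩, hu, rfl⟩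
  refine le_antisymm ((Nat.sInf_le hmem).trans huw) (le_csInf ⟨_, hmem⟩ ?_)
  rintro w ⟨v, hv, hv0, rfl⟩
  obtain ⟨u, rfl⟩ := (mem_span_row_iff G v).1 hv
  by_cases hu0 : ∃ a, (u a).coeff 0 ≠ 0
  · obtain ⟨a, ha⟩ := hu0
    exact h.lt_truncWeight hk hkn u a ha j hj
  · push Not at hu0
    refine absurd (funext fun c => ?_) hv0
    simp [Matrix.vecMul, dotProduct, finsetSum_coeff, mul_coeff_zero, hu0]

/-! ### Degrees of full-size minors -/

/-- A matrix over a field with linearly independent rows has a nonzero full-size minor. -/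
theorem exists_strictMono_det_ne_zero {N : Matrix (Fin k) (Fin n) F}
    (hN : LinearIndependent F N.row) :
    ∃ t : Fin k → Fin n, StrictMono t ∧ (N.submatrix id t).det ≠ 0 := by
  classical
  obtain ⟨κ, a, ha, hspan, hli⟩ := exists_linearIndependent' F N.col
  have : Finite κ := Finite.of_injective a ha
  have := Fintype.ofFinite κ
  have hcard : Fintype.card κ = k := by
    rw [← finrank_span_eq_card hli, hspan, ← Matrix.rank_eq_finrank_span_cols, hN.rank_matrix,
      Fintype.card_fin]
  set T : Finset (Fin n) := Finset.univ.image a with hT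
  have hTcard : T.card = k := by
    rw [hT, Finset.card_image_of_injective _ ha, Finset.card_univ, hcard]
  refine ⟨T.orderEmbOfFin hTcard, (T.orderEmbOfFin hTcard).strictMono, ?_⟩
  have hmem : ∀ i, ∃ x, a x = T.orderEmbOfFin hTcard i := fun i => by
    obtain ⟨x, _, hx⟩ := Finset.mem_image.1 (T.orderEmbOfFin_mem hTcard i)
    exact ⟨x, hx⟩
  choose f hf using hmem
  have hfinj : Function.Injective f := fun i i' h => by
    apply (T.orderEmbOfFin hTcard).injective
    rw [← hf, ← hf, h]
  have hcols : LinearIndependent F (N.submatrix id (T.orderEmbOfFin hTcard)).col := by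
    have h1 : (N.submatrix id (T.orderEmbOfFin hTcard)).col = (N.col ∘ a) ∘ f := by
      ext i b
      simp [Matrix.col_apply, hf]
    rw [h1]
    exact hli.comp f hfinj
  exact ((Matrix.isUnit_iff_isUnit_det _).1
    (Matrix.linearIndependent_cols_iff_isUnit.1 hcols)).ne_zero

theorem natDegree_prod_le_sum {ι : Type*} (s : Finset ι) (f : ι → F[X]) (d : ι → ℕ)
    (h : ∀ i ∈ s, (f i).natDegree ≤ d i) : (∏ i ∈ s, f i).natDegree ≤ ∑ i ∈ s, d i :=
  (natDegree_prod_le s f).trans (Finset.sum_le_sum h)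

theorem coeff_prod_sum_of_natDegree_le {ι : Type*} (s : Finset ι) (f : ι → F[X]) (d : ι → ℕ)
    (h : ∀ i ∈ s, (f i).natDegree ≤ d i) :
    (∏ i ∈ s, f i).coeff (∑ i ∈ s, d i) = ∏ i ∈ s, (f i).coeff (d i) := by
  classical
  induction s using Finset.induction_on with
  | empty => simp
  | insert a s ha ih =>
    rw [Finset.prod_insert ha, Finset.sum_insert ha, Finset.prod_insert ha,
      coeff_mul_add_eq_of_natDegree_le (h a (Finset.mem_insert_self a s))
        (natDegree_prod_le_sum s f d fun i hi => h i (Finset.mem_insert_of_mem hi)),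
      ih fun i hi => h i (Finset.mem_insert_of_mem hi)]

theorem natDegree_det_le_sum (A : Matrix (Fin k) (Fin k) F[X]) (d : Fin k → ℕ)
    (h : ∀ i j, (A i j).natDegree ≤ d i) : A.det.natDegree ≤ ∑ i, d i := by
  rw [← Matrix.det_transpose, Matrix.det_apply]
  refine natDegree_sum_le_of_forall_le _ _ fun σ _ => (natDegree_smul_le _ _).trans ?_
  exact natDegree_prod_le_sum _ _ _ fun i _ => h i (σ i)

/-- Every Leibniz term takes one entry from each row, so its coefficient at `∑ i, d i` is the
product of the entries' coefficients at `d i`. -/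
theorem coeff_det_sum (A : Matrix (Fin k) (Fin k) F[X]) (d : Fin k → ℕ)
    (h : ∀ i j, (A i j).natDegree ≤ d i) :
    A.det.coeff (∑ i, d i) = (Matrix.of fun i j => (A i j).coeff (d i)).det := by
  rw [← Matrix.det_transpose, Matrix.det_apply, ← Matrix.det_transpose (Matrix.of _),
    Matrix.det_apply, finsetSum_coeff]
  refine Finset.sum_congr rfl fun σ _ => ?_
  rw [coeff_smul]
  congr 1
  exact coeff_prod_sum_of_natDegree_le _ _ _ fun i _ => h i (σ i)

/-- If the rows of the leading row coefficient matrix with respect to the degrees `d` are linearly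
independent, then the highest degree of the full-size minors is `∑ i, d i`. -/
theorem isGreatest_natDegree_minors {G : Matrix (Fin k) (Fin n) F[X]} (d : Fin k → ℕ)
    (h : ∀ i j, (G i j).natDegree ≤ d i)
    (hN : LinearIndependent F (Matrix.of fun i j => (G i j).coeff (d i)).row) :
    IsGreatest {e : ℕ | ∃ t : Fin k → Fin n, StrictMono t ∧
      (G.submatrix id t).det ≠ 0 ∧ (G.submatrix id t).det.natDegree = e} (∑ i, d i) := by
  constructor
  · obtain ⟨t, ht, hdet⟩ := exists_strictMono_det_ne_zero hN
    have hc : (G.submatrix id t).det.coeff (∑ i, d i) ≠ 0 := by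
      rw [coeff_det_sum (G.submatrix id t) d fun i j => h i (t j)]
      exact hdet
    refine ⟨t, ht, fun h0 => hc (by rw [h0, coeff_zero]), le_antisymm ?_ ?_⟩
    · exact natDegree_det_le_sum _ d fun i j => h i (t j)
    · exact le_natDegree_of_ne_zero hc
  · rintro e ⟨t, -, -, rfl⟩
    exact natDegree_det_le_sum _ d fun i j => h i (t j)

/-! ### Consequences of the full row rank of `slidingBar` -/

/-- Linear independence of the rows of `slidingBar` forces the leading row coefficient matrix for
the degrees `m` (rows in `S`) and `m - 1` (other rows) to have linearly independent rows. -/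
theorem linearIndependent_leading {G : Matrix (Fin k) (Fin n) F[X]} {m r : ℕ} {S : Finset (Fin k)}
    (hm : 0 < m) (hSc : ∀ i, i ∉ S → ∀ j, (G i j).coeff m = 0)
    (hbar : LinearIndependent F (slidingBar G m r S).row) :
    LinearIndependent F
      (Matrix.of fun i j => (G i j).coeff (if i ∈ S then m else m - 1)).row := by
  classical
  -- Take the lowest retained copy of each row of `G`. These rows vanish outside block column `r`,
  -- where they hold the leading coefficients.
  set f : Fin k → {p : Fin (r + m + 1) × Fin k // (p.1 : ℕ) < r + m ∨ p.2 ∈ S} := fun i =>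
    if hi : i ∈ S then ⟨(⟨r + m, by omega⟩, i), Or.inr hi⟩
    else ⟨(⟨r + m - 1, by omega⟩, i), Or.inl (by simp; omega)⟩ with hf
  have hf2 : ∀ i, (f i).1.2 = i := fun i => by
    simp only [hf]; split_ifs <;> rfl
  have hf1 : ∀ i, ((f i).1.1 : ℕ) = r + if i ∈ S then m else m - 1 := fun i => by
    simp only [hf]; split_ifs
    · rfl
    · exact Nat.add_sub_assoc hm r
  have hfinj : Function.Injective f := fun i i' h => by rw [← hf2 i, h, hf2]
  have h1 := Fintype.linearIndependent_iff.1 (hbar.comp f hfinj)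
  rw [Fintype.linearIndependent_iff]
  refine fun g hg => h1 g (funext fun q => ?_)
  have h2 := congrFun hg q.2
  simp only [Finset.sum_apply, Pi.smul_apply, Matrix.row_apply, Matrix.of_apply, smul_eq_mul,
    Pi.zero_apply, Function.comp_apply, slidingBar] at h2 ⊢
  by_cases hq : (q.1 : ℕ) = r
  · rw [← h2]
    refine Finset.sum_congr rfl fun i _ => ?_
    rw [hf1, hf2, hq, if_pos (by split_ifs <;> omega), Nat.add_sub_cancel_left]
  · refine Finset.sum_eq_zero fun i _ => ?_
    have hq' := q.1.2
    rw [hf1, hf2]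
    by_cases hi : i ∈ S
    · rw [if_pos hi, if_neg (by omega), mul_zero]
    · rw [if_neg hi]
      split_ifs with hc
      · have : r + (m - 1) - (q.1 : ℕ) = m := by omega
        rw [this, hSc i hi, mul_zero]
      · exact mul_zero _

/-- Linear independence of the rows of `slidingBar` forces `G` to be left prime. -/
theorem isLeftPrime_of_slidingBar {G : Matrix (Fin k) (Fin n) F[X]} {m r : ℕ}
    {S : Finset (Fin k)} (hm : 0 < m) (hdeg : ∀ i j, (G i j).natDegree ≤ m)
    (hSc : ∀ i, i ∉ S → ∀ j, (G i j).coeff m = 0)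
    (hbar : LinearIndependent F (slidingBar G m r S).row) : IsLeftPrime G := by
  classical
  intro M G' hG
  by_contra hM
  rw [Matrix.isUnit_iff_isUnit_det, isUnit_iff_degree_eq_zero] at hM
  obtain ⟨l, hl⟩ := IsAlgClosed.exists_aeval_eq_zero (AlgebraicClosure F) M.det hM
  rw [AlgHom.map_det] at hl
  obtain ⟨w, hw, hw0⟩ := Matrix.exists_vecMul_eq_zero_iff.2 hl
  have hwG : ∀ c, ∑ a, w a * aeval l (G a c) = 0 := fun c => by
    have h1 : Matrix.vecMul w ((aeval l).mapMatrix M * G'.map (aeval l)) c = 0 := by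
      rw [← Matrix.vecMul_vecMul, hw0, Matrix.zero_vecMul, Pi.zero_apply]
    rw [← h1]
    simp [Matrix.vecMul, dotProduct, hG, Matrix.mul_apply]
  obtain ⟨a₀, ha₀⟩ := Function.ne_iff.1 hw
  -- An `F`-linear functional brings the relation `w G(l) = 0` down to `F`; the coefficient at `(0,
  -- a₀)` is `φ (w a₀)`, so the dependency is nontrivial.
  obtain ⟨φ, hφ⟩ : ∃ φ : Module.Dual F (AlgebraicClosure F), φ (w a₀) ≠ 0 := by
    by_contra! h0
    exact ha₀ ((Module.forall_dual_apply_eq_zero_iff F _).1 h0)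
  have h1 := Fintype.linearIndependent_iff.1 hbar (fun p => φ (l ^ (p.1.1 : ℕ) * w p.1.2))
    (funext fun q => ?_) ⟨(0, a₀), Or.inl (by simp; omega)⟩
  · simp at h1
    exact hφ h1
  simp only [Finset.sum_apply, Pi.smul_apply, Matrix.row_apply, Matrix.of_apply, smul_eq_mul,
    Pi.zero_apply, slidingBar]
  have hq := q.1.2
  have hcoeff : ∀ p : Fin (r + m + 1) × Fin k,
      (if (q.1 : ℕ) ≤ (p.1 : ℕ) ∧ (p.1 : ℕ) ≤ (q.1 : ℕ) + m then
        (G p.2 q.2).coeff ((p.1 : ℕ) - (q.1 : ℕ)) else 0) =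
      (X ^ (q.1 : ℕ) * G p.2 q.2).coeff p.1 := by
    intro p
    rw [coeff_X_pow_mul']
    split_ifs with h2 h3 h3
    · rfl
    · exact absurd h2.1 h3
    · refine (coeff_eq_zero_of_natDegree_lt ?_).symm
      have := hdeg p.2 q.2
      omega
    · rfl
  simp only [hcoeff]
  -- The discarded rows are zero, so the sum may run over all pairs and becomes an evaluation at
  -- `l`.
  have hzero : ∀ p : Fin (r + m + 1) × Fin k, ¬ ((p.1 : ℕ) < r + m ∨ p.2 ∈ S) →
      (X ^ (q.1 : ℕ) * G p.2 q.2).coeff p.1 = 0 := by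
    intro p hp
    rw [not_or] at hp
    rw [← hcoeff]
    have := p.1.2
    split_ifs with h2
    · have h3 : (p.1 : ℕ) - (q.1 : ℕ) = m := by omega
      rw [h3, hSc _ hp.2]
    · rfl
  refine (Fintype.sum_of_injective Subtype.val Subtype.val_injective _
    (fun p : Fin (r + m + 1) × Fin k => φ (l ^ (p.1 : ℕ) * w p.2) *
      (X ^ (q.1 : ℕ) * G p.2 q.2).coeff p.1)
    (fun p hp => by
      rw [hzero p fun h => hp ⟨⟨p, h⟩, rfl⟩, mul_zero]) (fun _ => rfl)).trans ?_
  rw [Fintype.sum_prod_type, Finset.sum_comm]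
  have haeval : ∀ a, ∑ p : Fin (r + m + 1), φ (l ^ (p : ℕ) * w a) *
      (X ^ (q.1 : ℕ) * G a q.2).coeff p = φ (l ^ (q.1 : ℕ) * (w a * aeval l (G a q.2))) := by
    intro a
    have hd : (X ^ (q.1 : ℕ) * G a q.2).natDegree < r + m + 1 := by
      refine natDegree_mul_le.trans_lt ?_
      rw [natDegree_X_pow]
      have := hdeg a q.2
      omega
    have h2 : l ^ (q.1 : ℕ) * (w a * aeval l (G a q.2)) =
        w a * aeval l (X ^ (q.1 : ℕ) * G a q.2) := by
      rw [map_mul, map_pow, aeval_X]; ring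
    rw [h2, aeval_eq_sum_range' hd, Finset.mul_sum, map_sum]
    refine (Fin.sum_univ_eq_sum_range
      (fun p => φ (l ^ p * w a) * (X ^ (q.1 : ℕ) * G a q.2).coeff p) _).trans ?_
    refine Finset.sum_congr rfl fun p _ => ?_
    rw [mul_smul_comm, map_smul, smul_eq_mul, mul_comm, mul_comm (w a)]
  simp only [haeval]
  rw [← map_sum, ← Finset.mul_sum, hwG, mul_zero, map_zero]

end Aux

end ConvCode

theorem mainTheorem6 {F : Type*} [Field F] [Finite F] (n k δ m L : ℕ)
    (hk : 0 < k) (hkn : k < n) (hkδ : ¬ k ∣ δ)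
    (hm : m = δ / k + 1) (hL : L = δ / (n - k) + m - 1)
    (G : Matrix (Fin k) (Fin n) F[X])
    (hdeg : ∀ i j, (G i j).natDegree ≤ m)
    (hred : ConvCode.IsRowReduced G)
    (hminors : ConvCode.MinorCriterion G L)
    (r : ℕ) (S : Finset (Fin k)) (hS : S.card = δ - k * (δ / k))
    (hSc : ∀ i, i ∉ S → ∀ j, (G i j).coeff m = 0)
    (hbar : LinearIndependent F (ConvCode.slidingBar G m r S).row) :
    ∃ C : Submodule F[X] (Fin n → F[X]),
      ConvCode.IsConvolutionalCode C k δ ∧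
      ConvCode.IsGeneratorMatrix C G ∧
      ConvCode.IsNoncatastrophic C k ∧
      ConvCode.IsMDP C k δ := by
  classical
  have hm0 : 0 < m := hm ▸ Nat.succ_pos _
  have hgen : ConvCode.IsGeneratorMatrix (Submodule.span F[X] (Set.range G.row)) G :=
    ⟨hred.1, rfl⟩
  refine ⟨_, ⟨?_, G, hgen, ?_⟩, hgen,
    ⟨G, hgen, ConvCode.isLeftPrime_of_slidingBar hm0 hdeg hSc hbar⟩, fun j hj =>
    hminors.columnDistance_eq hk hkn.le j (by omega)⟩
  · rw [finrank_span_eq_card hred.1, Fintype.card_fin]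
  -- As `m - 1 = δ / k`, the sum is `k * (δ / k) + S.card`.
  · have hsum : ∑ i : Fin k, (if i ∈ S then m else m - 1) = δ := by
      have h1 : ∀ i : Fin k, (if i ∈ S then m else m - 1) = δ / k + if i ∈ S then 1 else 0 :=
        fun i => by split_ifs <;> omega
      have h2 := Nat.mul_div_le δ k
      simp only [h1, Finset.sum_add_distrib, Finset.sum_const, Finset.card_univ, Fintype.card_fin,
        smul_eq_mul, Finset.sum_ite_mem, Finset.univ_inter, hS, mul_one]
      omega
    rw [← hsum]
    refine ConvCode.isGreatest_natDegree_minors _ (fun i j => ?_)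
      (ConvCode.linearIndependent_leading hm0 hSc hbar)
    split_ifs with hi
    · exact hdeg i j
    · refine natDegree_le_iff_coeff_eq_zero.2 fun N hN => ?_
      rcases (show m ≤ N by omega).eq_or_lt with h | h
      · rw [← h, hSc i hi]
      · exact coeff_eq_zero_of_natDegree_lt ((hdeg i j).trans_lt h)
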